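/- Let $\Gamma$ be a countably infinite connected graph with symmetric edge weights $\mu_{x,y}=\mu_{y,x}>0$ for $x\sim y$ (and $\mu_{x,y}=0$ otherwise), and with $\mu(x)=\sum_{y\sim x}\mu_{x,y}<\infty$. Put $P(x,y)=\mu_{x,y}/\mu(x)$, $Pf(x)=\sum_y P(x,y)f(y)$, $\Delta=P-I$, $(f,g)_\mu=\sum_x f(x)g(x)\mu(x)$, let $d$ be the graph distance and $B(x,R)=\{y: d(x,y)<R\}$. For disjoint $A,B\subset\Gamma$ let $$\rho(A,B)=\Bigl(\inf\{(-\Delta f,f)_\mu : f \text{ finitely supported},\ f|_A=1,\ f|_B=0\}\Bigr)^{-1},\qquad \rho(x,r,R)=\rho\bigl(B(x,r),\Gamma\setminus B(x,R)\bigr).$$ Assume - $(p_0)$: there is $p_0>0$ with $\mu_{x,y}/\mu(x)\ge p_0$ for all $x\sim y$; - $(H)$: there is $H>1$ such that for all $x\in\Gamma$, all real $R>0$ and every function $u\ge 0$ defined on $B(x,2R)$ and its neighbours with $Pu=u$ on $B(x,2R)$, one has $\max_{B(x,R)}u\le H\min_{B(x,R)}u$. Then there is a constant $C_2>1$ such that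 for all $x\in\Gamma$ and all real $R>0$ $$\rho(x,R,4R)\le C_2\,\rho(x,2R,4R)\quad\text{and}\quad \rho(x,R,2R)\le (C_2-1)\,\rho(x,2R,4R).$$ If in addition - $(BC)$: there is an integer $K$ such that for all $x\in\Gamma$ and $R>0$ the ball $B(x,2R)$ can be covered by at most $K$ balls of radius $R$, then there is also a constant $C_1>1$ such that for all $x\in\Gamma$ and all real $R>0$ $$\rho(x,R,4R)\le C_1\,\rho(x,R,2R)\quad\text{and}\quad \rho(x,2R,4R)\le (C_1-1)\,\rho(x,R,2R),$$ and hence, with the same $C_2$ as above, $$\frac{1}{C_1-1}\,\rho(x,2R,4R)\le\rho(x,R,2R)\le (C_2-1)\,\rho(x,2R,4R).$$ -/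

import Mathlib

open scoped ENNReal

/-- A weighted graph `(Γ, μ)`: symmetric weights, positive on the edges and zero off the edges,
such that every vertex has finite total weight. -/
structure WeightedGraph (Γ : Type*) where
  graph : SimpleGraph Γ
  weight : Γ → Γ → ℝ
  weight_symm : ∀ x y, weight x y = weight y x
  weight_pos : ∀ x y, graph.Adj x y → 0 < weight x y
  weight_eq_zero : ∀ x y, ¬ graph.Adj x y → weight x y = 0
  weight_summable : ∀ x, Summable (weight x)

namespace WeightedGraph

noncomputable section

variable {Γ : Type*} (G : WeightedGraph Γ)

/-- The vertex weight `μ(x) = ∑_{y ∼ x} μ_{x,y}`. -/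
def vertexWeight (x : Γ) : ℝ := ∑' y, G.weight x y

/-- The transition probability `P(x,y) = μ_{x,y} / μ(x)`. -/
def transition (x y : Γ) : ℝ := G.weight x y / G.vertexWeight x

/-- The Markov operator `Pf(x) = ∑_y P(x,y) f(y)`. -/
def markovOp (f : Γ → ℝ) (x : Γ) : ℝ := ∑' y, G.transition x y * f y

/-- The Laplace operator `Δ = P - I`. -/
def laplacian (f : Γ → ℝ) (x : Γ) : ℝ := G.markovOp f x - f x

/-- The inner product `(f,g)_μ = ∑_x f(x) g(x) μ(x)`; it is only used when `g` has finite
support. -/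
def innerProd (f g : Γ → ℝ) : ℝ := ∑ᶠ x, f x * g x * G.vertexWeight x

/-- The Dirichlet energy `(-Δf, f)_μ`. -/
def energy (f : Γ → ℝ) : ℝ := G.innerProd (fun x => -G.laplacian f x) f

/-- The open ball `B(x,R) = {y : d(x,y) < R}` of the graph distance. -/
def ball (x : Γ) (R : ℝ) : Set Γ := {y | (G.graph.dist x y : ℝ) < R}

/-- The closure of `A`: `A` together with all neighbours of points of `A`. -/
def closure (A : Set Γ) : Set Γ := {y | y ∈ A ∨ ∃ x ∈ A, G.graph.Adj x y}

/-- The resistance between `A` and `B`, the inverse of the infimum of `(-Δf, f)_μ` over the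
finitely supported `f` with `f = 1` on `A` and `f = 0` on `B`. -/
def resistance (A B : Set Γ) : ℝ≥0∞ :=
  (⨅ f ∈ {f : Γ → ℝ | f.support.Finite ∧ (∀ x ∈ A, f x = 1) ∧ (∀ x ∈ B, f x = 0)},
    ENNReal.ofReal (G.energy f))⁻¹

/-- The resistance `ρ(x,r,R)` of the annulus: between `B(x,r)` and `Γ \ B(x,R)`. -/
def annulusResistance (x : Γ) (r R : ℝ) : ℝ≥0∞ :=
  G.resistance (G.ball x r) (G.ball x R)ᶜ

/-- Condition `(p₀)`. -/
def CondP0 : Prop :=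
  ∃ p₀ : ℝ, 0 < p₀ ∧ ∀ x y, G.graph.Adj x y → p₀ ≤ G.weight x y / G.vertexWeight x

/-- The bounded covering condition `(BC)`. -/
def BoundedCovering : Prop :=
  ∃ K : ℕ, ∀ (x : Γ) (R : ℝ), 0 < R →
    ∃ s : Finset Γ, s.card ≤ K ∧ G.ball x (2 * R) ⊆ ⋃ y ∈ s, G.ball y R

/-- `u` is harmonic on `A`. Only the values of `u` on the closure of `A` matter. -/
def HarmonicOn (u : Γ → ℝ) (A : Set Γ) : Prop :=
  ∀ x ∈ A, G.markovOp u x = u x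

/-- The elliptic Harnack inequality `(H)`. -/
def EllipticHarnack : Prop :=
  ∃ H : ℝ, 1 < H ∧ ∀ (x : Γ) (R : ℝ), 0 < R → ∀ u : Γ → ℝ,
    G.HarmonicOn u (G.ball x (2 * R)) →
    (∀ y ∈ G.closure (G.ball x (2 * R)), 0 ≤ u y) →
    ∀ y ∈ G.ball x R, ∀ z ∈ G.ball x R, u y ≤ H * u z

end

end WeightedGraph

/-!
Let `g` be the Green function of `B(x, 4R)` with pole `x`. Cauchy–Schwarz for the Dirichlet form,
applied to truncations of `g`, shows that `ρ(x, r, 4R)` lies between the minimum of `g` on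
`B(x, r)` and its maximum off `B(x, r - 1)`, so everything reduces to comparing values of Green
functions.

By the elliptic Harnack inequality `g` is comparable to a constant on annuli around `x`. Near the
pole this uses chains of balls along geodesics starting at `x`, which would run into the pole;
the symmetry `g_x(y) = g_y(x)` moves the pole away from the chain. This gives the comparison of
`ρ(x, R, 4R)` with `ρ(x, 2R, 4R)`.

For the comparison with `ρ(x, R, 2R)`, let `g'` be the Green function of `B(x, 2R)` and let `M` be
the maximum of `g` on a sphere of radius proportional to `R`. The function `M - g` is superharmonic
off `x`, nonnegative on and outside that sphere, and equal to `M` on a ball around a point `w`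
outside `B(x, 4R)`. Comparing it with the Green function of a larger ball around `w`, which avoids
the vicinity of `x`, gives a point `z` near the sphere where `M - g` is at least a fixed proportion
of `M`. Since `M - g + g'` is nonnegative, and harmonic on `B(x, 2R)`, the Harnack inequality
bounds `M` by a multiple of `g'` on the sphere.

For bounded `R` the condition `(p₀)` bounds both resistances above and below by multiples of
`1 / μ(x)`.
-/

namespace WeightedGraph

variable {Γ : Type*}

section Distance

variable {S : SimpleGraph Γ}

/-- The points lying on some geodesic from `a` to `b`: the union of all geodesics along which a
Harnack chain from `a` to `b` may run. -/
def geodesicInterval (S : SimpleGraph Γ) (a b : Γ) : Set Γ :=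
  {p | S.dist a p + S.dist p b = S.dist a b}

theorem mem_geodesicInterval {a b p : Γ} :
    p ∈ geodesicInterval S a b ↔ S.dist a p + S.dist p b = S.dist a b :=
  Iff.rfl

theorem left_mem_geodesicInterval (a b : Γ) : a ∈ geodesicInterval S a b := by
  simp [mem_geodesicInterval]

theorem geodesicInterval_comm (a b : Γ) :
    geodesicInterval S a b = geodesicInterval S b a := by
  ext p
  rw [mem_geodesicInterval, mem_geodesicInterval, S.dist_comm (u := b) (v := p),
    S.dist_comm (u := p) (v := a), S.dist_comm (u := b) (v := a), add_comm]

variable (hS : S.Connected)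
include hS

theorem geodesicInterval_subset_of_mem {a b c : Γ} (hac : c ∈ geodesicInterval S a b) :
    geodesicInterval S c b ⊆ geodesicInterval S a b := by
  intro p hp
  have hacp := hS.dist_triangle (u := a) (v := c) (w := p)
  have hapb := hS.dist_triangle (u := a) (v := p) (w := b)
  rw [mem_geodesicInterval] at hac hp ⊢
  lia

theorem dist_le_two_mul_of_mem_geodesicInterval {x y z p : Γ} {k : ℕ}
    (hp : p ∈ geodesicInterval S x z) (hyp : S.dist y p ≤ k)
    (hxy : S.dist x z ≤ S.dist x y) : S.dist y z ≤ 2 * k := by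
  have hxpy := hS.dist_triangle (u := x) (v := p) (w := y)
  have hypz := hS.dist_triangle (u := y) (v := p) (w := z)
  rw [S.dist_comm (u := p)] at hxpy
  rw [mem_geodesicInterval] at hp
  lia

theorem exists_mem_geodesicInterval_dist_eq {a b : Γ} {k : ℕ} (hk : k ≤ S.dist a b) :
    ∃ p ∈ geodesicInterval S a b, S.dist a p = k := by
  obtain ⟨w, hw⟩ := hS.exists_walk_length_eq_dist a b
  have htake := SimpleGraph.dist_le (w.take k)
  have hdrop := SimpleGraph.dist_le (w.drop k)
  have htri := hS.dist_triangle (u := a) (v := w.getVert k) (w := b)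
  simp only [SimpleGraph.Walk.take_length, SimpleGraph.Walk.drop_length] at htake hdrop
  refine ⟨w.getVert k, ?_, by lia⟩
  rw [mem_geodesicInterval]
  lia

theorem exists_adj_dist_add_one_eq {a b : Γ} (hab : S.dist a b ≠ 0) :
    ∃ c, S.Adj a c ∧ S.dist c b + 1 = S.dist a b := by
  obtain ⟨c, hc, hac⟩ := exists_mem_geodesicInterval_dist_eq hS (Nat.one_le_iff_ne_zero.2 hab)
  rw [mem_geodesicInterval] at hc
  exact ⟨c, SimpleGraph.dist_eq_one_iff_adj.1 hac, by lia⟩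

theorem dist_le_dist_add_one_of_adj (x : Γ) {p q : Γ} (h : S.Adj p q) :
    S.dist x q ≤ S.dist x p + 1 :=
  (SimpleGraph.dist_eq_one_iff_adj.2 h) ▸ hS.dist_triangle

theorem finite_setOf_dist_le [S.LocallyFinite] (x : Γ) (n : ℕ) :
    {y | S.dist x y ≤ n}.Finite := by
  induction n with
  | zero =>
    refine (Set.finite_singleton x).subset fun y hy => ?_
    exact (hS.dist_eq_zero_iff.1 (Nat.le_zero.1 hy)).symm
  | succ n ih =>
    refine (ih.union (ih.biUnion fun p _ => (S.neighborSet p).toFinite)).subset fun y hy => ?_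
    rcases Nat.le_succ_iff.1 hy with h | h
    · exact Or.inl h
    · rw [S.dist_comm] at h
      obtain ⟨p, hyp, hpx⟩ := exists_adj_dist_add_one_eq hS (h.trans_ne n.succ_ne_zero)
      have hxp : S.dist x p ≤ n := by
        rw [S.dist_comm]
        lia
      exact Or.inr (Set.mem_biUnion hxp hyp.symm)

theorem exists_dist_eq [Infinite Γ] [S.LocallyFinite] (x : Γ) (n : ℕ) :
    ∃ y, S.dist x y = n := by
  obtain ⟨z, hz⟩ := (finite_setOf_dist_le hS x n).exists_notMem
  obtain ⟨p, -, hp⟩ := exists_mem_geodesicInterval_dist_eq hS (not_le.1 hz).le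
  exact ⟨p, hp⟩

end Distance

variable {G : WeightedGraph Γ}

theorem mem_ball {x y : Γ} {R : ℝ} : y ∈ G.ball x R ↔ (G.graph.dist x y : ℝ) < R :=
  Iff.rfl

theorem notMem_ball {x y : Γ} {R : ℝ} : y ∉ G.ball x R ↔ R ≤ (G.graph.dist x y : ℝ) := by
  rw [mem_ball, not_lt]

theorem mem_ball_self {x : Γ} {R : ℝ} (hR : 0 < R) : x ∈ G.ball x R := by
  simpa [ball] using hR

theorem ball_subset_ball (x : Γ) {r R : ℝ} (h : r ≤ R) : G.ball x r ⊆ G.ball x R :=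
  fun _ hy => lt_of_lt_of_le hy h

theorem finite_ball [G.graph.LocallyFinite] (hc : G.graph.Connected) (x : Γ) (R : ℝ) :
    (G.ball x R).Finite :=
  (finite_setOf_dist_le hc x ⌈R⌉₊).subset fun _ hy => (Nat.lt_ceil.2 hy).le

theorem subset_closure (A : Set Γ) : A ⊆ G.closure A := fun _ => Or.inl

theorem mem_closure_of_adj {A : Set Γ} {p q : Γ} (hp : p ∈ A) (h : G.graph.Adj p q) :
    q ∈ G.closure A :=
  Or.inr ⟨p, hp, h⟩

theorem exists_adj_of_mem_closure_diff {A : Set Γ} {q : Γ} (hq : q ∈ G.closure A \ A) :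
    ∃ p ∈ A, G.graph.Adj p q :=
  hq.1.resolve_left hq.2

theorem finite_closure [G.graph.LocallyFinite] {A : Set Γ} (hA : A.Finite) :
    (G.closure A).Finite := by
  refine (hA.union (hA.biUnion fun p _ => (G.graph.neighborSet p).toFinite)).subset ?_
  rintro y (hy | ⟨p, hp, hadj⟩)
  · exact Or.inl hy
  · exact Or.inr (Set.mem_biUnion hp hadj)

section Weights

theorem weight_nonneg (x y : Γ) : 0 ≤ G.weight x y := by
  by_cases h : G.graph.Adj x y
  · exact (G.weight_pos x y h).le
  · exact (G.weight_eq_zero x y h).ge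

theorem weight_le_vertexWeight (x y : Γ) : G.weight x y ≤ G.vertexWeight x :=
  (G.weight_summable x).le_tsum y fun _ _ => weight_nonneg _ _

theorem vertexWeight_nonneg (x : Γ) : 0 ≤ G.vertexWeight x :=
  tsum_nonneg (weight_nonneg x)

theorem vertexWeight_pos_of_adj {x y : Γ} (h : G.graph.Adj x y) : 0 < G.vertexWeight x :=
  (G.weight_pos x y h).trans_le (weight_le_vertexWeight x y)

theorem vertexWeight_pos [Nontrivial Γ] (hc : G.graph.Connected) (x : Γ) :
    0 < G.vertexWeight x :=
  (hc.preconnected.exists_adj_of_nontrivial x).elim fun _ => vertexWeight_pos_of_adj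

theorem transition_nonneg (x y : Γ) : 0 ≤ G.transition x y :=
  div_nonneg (weight_nonneg x y) (vertexWeight_nonneg x)

theorem transition_le_one (x y : Γ) : G.transition x y ≤ 1 :=
  div_le_one_of_le₀ (weight_le_vertexWeight x y) (vertexWeight_nonneg x)

theorem transition_pos_of_adj {x y : Γ} (h : G.graph.Adj x y) : 0 < G.transition x y :=
  div_pos (G.weight_pos x y h) (vertexWeight_pos_of_adj h)

theorem transition_eq_zero {x y : Γ} (h : ¬ G.graph.Adj x y) : G.transition x y = 0 := by
  rw [transition, G.weight_eq_zero x y h, zero_div]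

theorem finite_neighborSet {c : ℝ} (hc : 0 < c) {x : Γ}
    (h : ∀ y, G.graph.Adj x y → c ≤ G.transition x y) : (G.graph.neighborSet x).Finite := by
  have htendsto : Filter.Tendsto (G.transition x) Filter.cofinite (nhds 0) :=
    ((G.weight_summable x).div_const _).tendsto_cofinite_zero
  exact (Filter.eventually_cofinite.1 (htendsto.eventually_lt_const hc)).subset
    fun y hy => not_lt.2 (h y hy)

end Weights

section Laplacian

variable [G.graph.LocallyFinite]

theorem markovOp_eq_sum (u : Γ → ℝ) (p : Γ) :
    G.markovOp u p = ∑ y ∈ G.graph.neighborFinset p, G.transition p y * u y :=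
  tsum_eq_sum fun y hy => by
    rw [transition_eq_zero (by simpa using hy), zero_mul]

theorem vertexWeight_eq_sum (p : Γ) :
    G.vertexWeight p = ∑ y ∈ G.graph.neighborFinset p, G.weight p y :=
  tsum_eq_sum fun y hy => G.weight_eq_zero p y (by simpa using hy)

theorem sum_transition {p : Γ} (hp : 0 < G.vertexWeight p) :
    ∑ y ∈ G.graph.neighborFinset p, G.transition p y = 1 := by
  simp only [transition, ← Finset.sum_div, ← vertexWeight_eq_sum, div_self hp.ne']

theorem laplacian_eq_sum (u : Γ → ℝ) {p : Γ} (hp : 0 < G.vertexWeight p) :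
    G.laplacian u p = ∑ y ∈ G.graph.neighborFinset p, G.transition p y * (u y - u p) := by
  simp only [mul_sub, Finset.sum_sub_distrib, ← Finset.sum_mul, sum_transition hp, one_mul,
    laplacian, markovOp_eq_sum]

theorem transition_mul_le_markovOp {u : Γ → ℝ} (hu : ∀ q, 0 ≤ u q) (p q : Γ) :
    G.transition p q * u q ≤ G.markovOp u p := by
  rw [markovOp_eq_sum]
  by_cases h : G.graph.Adj p q
  · exact Finset.single_le_sum (f := fun y => G.transition p y * u y)
      (fun y _ => mul_nonneg (transition_nonneg p y) (hu y)) (by simpa using h)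
  · rw [transition_eq_zero h, zero_mul]
    exact Finset.sum_nonneg fun y _ => mul_nonneg (transition_nonneg p y) (hu y)

/-- The Laplace operator as a linear map; local finiteness makes the sum defining `P` finite,
so that it acts on all functions. Used to solve the Dirichlet problem by a dimension count. -/
noncomputable def laplacianLinearMap (G : WeightedGraph Γ) [G.graph.LocallyFinite] :
    (Γ → ℝ) →ₗ[ℝ] (Γ → ℝ) where
  toFun := G.laplacian
  map_add' u v := by
    ext p
    simp only [laplacian, markovOp_eq_sum, Pi.add_apply, mul_add, Finset.sum_add_distrib]
    ring
  map_smul' c u := by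
    ext p
    simp only [laplacian, markovOp_eq_sum, Pi.smul_apply, smul_eq_mul, RingHom.id_apply, mul_sub,
      Finset.mul_sum, mul_left_comm]

theorem laplacian_sub (u v : Γ → ℝ) (p : Γ) :
    G.laplacian (fun q => u q - v q) p = G.laplacian u p - G.laplacian v p :=
  congrFun (G.laplacianLinearMap.map_sub u v) p

theorem laplacian_const_mul (c : ℝ) (u : Γ → ℝ) (p : Γ) :
    G.laplacian (fun q => c * u q) p = c * G.laplacian u p :=
  congrFun (G.laplacianLinearMap.map_smul c u) p

theorem laplacian_const (c : ℝ) {p : Γ} (hp : 0 < G.vertexWeight p) :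
    G.laplacian (fun _ => c) p = 0 := by
  simp [laplacian_eq_sum _ hp]

theorem laplacian_const_sub (c : ℝ) (u : Γ → ℝ) {p : Γ} (hp : 0 < G.vertexWeight p) :
    G.laplacian (fun q => c - u q) p = -G.laplacian u p := by
  rw [laplacian_sub, laplacian_const c hp, zero_sub]

theorem eq_of_laplacian_nonpos_of_forall_adj_le {w : Γ → ℝ} {p : Γ} (hp : G.laplacian w p ≤ 0)
    (hmin : ∀ y, G.graph.Adj p y → w p ≤ w y) {y : Γ} (hy : G.graph.Adj p y) : w y = w p := by
  rw [laplacian_eq_sum w (vertexWeight_pos_of_adj hy)] at hp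
  have hterm : ∀ z ∈ G.graph.neighborFinset p, 0 ≤ G.transition p z * (w z - w p) := fun z hz =>
    mul_nonneg (transition_nonneg p z) (sub_nonneg.2 (hmin z (by simpa using hz)))
  have hzero := (Finset.sum_eq_zero_iff_of_nonneg hterm).1
    (hp.antisymm (Finset.sum_nonneg hterm)) y (by simpa using hy)
  exact sub_eq_zero.1 ((mul_eq_zero_iff_left (transition_pos_of_adj hy).ne').1 hzero)

variable (hc : G.graph.Connected) {U : Set Γ} (hU : U.Finite) (hU' : Uᶜ.Nonempty)
include hc hU hU'

theorem minimum_principle {w : Γ → ℝ} (hw : ∀ p ∈ U, G.laplacian w p ≤ 0)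
    (hbd : ∀ p ∈ G.closure U \ U, 0 ≤ w p) : ∀ p ∈ U, 0 ≤ w p := by
  by_contra! hneg
  obtain ⟨p₁, hp₁, hneg⟩ := hneg
  obtain ⟨p₂, hp₂, hmin⟩ := Set.exists_min_image U w hU ⟨p₁, hp₁⟩
  obtain ⟨q, hq⟩ := hU'
  obtain ⟨walk⟩ := hc.preconnected p₂ q
  obtain ⟨e, -, ⟨haU, ha⟩, hb⟩ := walk.exists_boundary_dart {p | p ∈ U ∧ w p = w p₂}
    ⟨hp₂, rfl⟩ fun h => hq h.1
  have hlt : w e.fst < 0 := ha.trans_lt ((hmin p₁ hp₁).trans_lt hneg)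
  have hle : ∀ y, G.graph.Adj e.fst y → w e.fst ≤ w y := fun y hy => by
    by_cases hyU : y ∈ U
    · exact ha.trans_le (hmin y hyU)
    · exact hlt.le.trans (hbd y ⟨mem_closure_of_adj haU hy, hyU⟩)
  have heq := eq_of_laplacian_nonpos_of_forall_adj_le (hw _ haU) hle e.adj
  have hbU : e.snd ∉ U := fun h => hb ⟨h, heq.trans ha⟩
  linarith [hbd e.snd ⟨mem_closure_of_adj haU e.adj, hbU⟩]

theorem comparison_principle {u v : Γ → ℝ} (hlap : ∀ p ∈ U, G.laplacian v p ≤ G.laplacian u p)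
    (hbd : ∀ p ∈ G.closure U \ U, u p ≤ v p) : ∀ p ∈ U, u p ≤ v p := by
  intro p hp
  refine sub_nonneg.1 (minimum_principle hc hU hU' (w := fun q => v q - u q) (fun q hq => ?_)
    (fun q hq => sub_nonneg.2 (hbd q hq)) p hp)
  rw [laplacian_sub]
  exact sub_nonpos.2 (hlap q hq)

theorem exists_laplacian_eq (φ : Γ → ℝ) :
    ∃ u : Γ → ℝ, (∀ p ∉ U, u p = 0) ∧ ∀ p ∈ U, G.laplacian u p = φ p := by
  have := hU.to_subtype
  let extend : (U → ℝ) →ₗ[ℝ] (Γ → ℝ) := Function.ExtendByZero.linearMap ℝ Subtype.val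
  have extend_coe (f : U → ℝ) (p : U) : extend f p = f p :=
    Subtype.val_injective.extend_apply f (0 : Γ → ℝ) p
  have extend_of_notMem (f : U → ℝ) {p : Γ} (hp : p ∉ U) : extend f p = 0 :=
    Function.extend_apply' f (0 : Γ → ℝ) p fun ⟨q, hq⟩ => hp (hq ▸ q.2)
  let T : (U → ℝ) →ₗ[ℝ] (U → ℝ) :=
    LinearMap.funLeft ℝ ℝ Subtype.val ∘ₗ G.laplacianLinearMap ∘ₗ extend
  have hT : Function.Injective T := by
    intro f f' hff
    have hle {f f' : U → ℝ} (h : T f = T f') : f ≤ f' := fun p => by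
      rw [← extend_coe f, ← extend_coe f']
      refine comparison_principle hc hU hU' (fun q hq => (congrFun h ⟨q, hq⟩).ge)
        (fun q hq => ?_) p p.2
      rw [extend_of_notMem f hq.2, extend_of_notMem f' hq.2]
    exact (hle hff).antisymm (hle hff.symm)
  obtain ⟨f, hf⟩ := LinearMap.injective_iff_surjective.1 hT fun p => φ p
  exact ⟨extend f, fun p => extend_of_notMem f, fun p hp => congrFun hf ⟨p, hp⟩⟩

end Laplacian

section DirichletForm

/-- The Dirichlet form of the finite network induced on `V`, with every edge counted once. It is
the energy of functions vanishing off `D` as soon as `V` contains the closure of `D`. -/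
noncomputable def dirichletForm (G : WeightedGraph Γ) (V : Finset Γ) (f g : Γ → ℝ) : ℝ :=
  (∑ e ∈ V ×ˢ V, G.weight e.1 e.2 * ((f e.1 - f e.2) * (g e.1 - g e.2))) / 2

theorem dirichletForm_comm (V : Finset Γ) (f g : Γ → ℝ) :
    G.dirichletForm V f g = G.dirichletForm V g f := by
  simp only [dirichletForm, mul_comm (f _ - f _)]

theorem dirichletForm_le_of_adj {V : Finset Γ} {f g f' g' : Γ → ℝ}
    (h : ∀ p q, G.graph.Adj p q → (f p - f q) * (g p - g q) ≤ (f' p - f' q) * (g' p - g' q)) :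
    G.dirichletForm V f g ≤ G.dirichletForm V f' g' := by
  refine div_le_div_of_nonneg_right (Finset.sum_le_sum fun e _ => ?_) zero_le_two
  by_cases he : G.graph.Adj e.1 e.2
  · exact mul_le_mul_of_nonneg_left (h _ _ he) (weight_nonneg _ _)
  · simp only [G.weight_eq_zero _ _ he, zero_mul, le_refl]

theorem dirichletForm_congr_of_adj {V : Finset Γ} {f g f' g' : Γ → ℝ}
    (h : ∀ p q, G.graph.Adj p q → (f p - f q) * (g p - g q) = (f' p - f' q) * (g' p - g' q)) :
    G.dirichletForm V f g = G.dirichletForm V f' g' :=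
  (dirichletForm_le_of_adj fun p q hpq => (h p q hpq).le).antisymm
    (dirichletForm_le_of_adj fun p q hpq => (h p q hpq).ge)

theorem dirichletForm_self_nonneg (V : Finset Γ) (f : Γ → ℝ) : 0 ≤ G.dirichletForm V f f :=
  div_nonneg (Finset.sum_nonneg fun _ _ => mul_nonneg (weight_nonneg _ _) (mul_self_nonneg _))
    zero_le_two

theorem dirichletForm_const_mul (V : Finset Γ) (c : ℝ) (f g : Γ → ℝ) :
    G.dirichletForm V (fun q => c * f q) (fun q => c * g q) = c ^ 2 * G.dirichletForm V f g := by
  simp only [dirichletForm, ← mul_sub, ← mul_div_assoc, Finset.mul_sum]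
  congr 1
  exact Finset.sum_congr rfl fun _ _ => by ring

theorem sq_dirichletForm_le (V : Finset Γ) (f g : Γ → ℝ) :
    G.dirichletForm V f g ^ 2 ≤ G.dirichletForm V f f * G.dirichletForm V g g := by
  have hcs := Finset.sum_sq_le_sum_mul_sum_of_sq_le_mul (V ×ˢ V)
    (r := fun e => G.weight e.1 e.2 * ((f e.1 - f e.2) * (g e.1 - g e.2)))
    (f := fun e => G.weight e.1 e.2 * ((f e.1 - f e.2) * (f e.1 - f e.2)))
    (g := fun e => G.weight e.1 e.2 * ((g e.1 - g e.2) * (g e.1 - g e.2)))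
    (fun _ _ => mul_nonneg (weight_nonneg _ _) (mul_self_nonneg _))
    (fun _ _ => mul_nonneg (weight_nonneg _ _) (mul_self_nonneg _)) (fun _ _ => le_of_eq (by ring))
  rw [dirichletForm, dirichletForm, dirichletForm, div_pow, div_mul_div_comm, ← sq]
  gcongr

variable [G.graph.LocallyFinite]

theorem laplacian_mul_vertexWeight (f : Γ → ℝ) {p : Γ} {V : Finset Γ}
    (hV : ∀ q, G.graph.Adj p q → q ∈ V) :
    G.laplacian f p * G.vertexWeight p = ∑ q ∈ V, G.weight p q * (f q - f p) := by
  rw [← Finset.sum_subset (s₁ := G.graph.neighborFinset p) (fun q hq => hV q (by simpa using hq))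
    fun q _ hq => by rw [G.weight_eq_zero p q (by simpa using hq), zero_mul]]
  rcases (vertexWeight_nonneg p).eq_or_lt with hp | hp
  · rw [← hp, mul_zero]
    refine (Finset.sum_eq_zero fun q hq => ?_).symm
    exact absurd hp (vertexWeight_pos_of_adj (show G.graph.Adj p q by simpa using hq)).ne
  · rw [laplacian_eq_sum f hp, Finset.sum_mul]
    refine Finset.sum_congr rfl fun q _ => ?_
    rw [transition, mul_right_comm, div_mul_cancel₀ _ hp.ne']

variable {D : Set Γ} {V : Finset Γ} (hV : G.closure D ⊆ V)
include hV

theorem dirichletForm_eq_sum_laplacian (f : Γ → ℝ) {g : Γ → ℝ} (hg : ∀ p ∉ D, g p = 0) :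
    G.dirichletForm V f g = ∑ p ∈ V, -G.laplacian f p * g p * G.vertexWeight p := by
  have hleft : ∑ p ∈ V, -G.laplacian f p * g p * G.vertexWeight p
      = ∑ p ∈ V, ∑ q ∈ V, G.weight p q * ((f p - f q) * g p) := by
    refine Finset.sum_congr rfl fun p _ => ?_
    by_cases hp : p ∈ D
    · have hlap := laplacian_mul_vertexWeight f fun q hq => hV (mem_closure_of_adj hp hq)
      calc -G.laplacian f p * g p * G.vertexWeight p
          = -g p * (G.laplacian f p * G.vertexWeight p) := by ring
        _ = ∑ q ∈ V, G.weight p q * ((f p - f q) * g p) := by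
          rw [hlap, Finset.mul_sum]
          exact Finset.sum_congr rfl fun q _ => by ring
    · simp only [hg p hp, mul_zero, zero_mul, Finset.sum_const_zero]
  have hright : ∑ p ∈ V, ∑ q ∈ V, G.weight p q * ((f p - f q) * g q)
      = -∑ p ∈ V, ∑ q ∈ V, G.weight p q * ((f p - f q) * g p) := by
    rw [Finset.sum_comm]
    simp only [← Finset.sum_neg_distrib]
    refine Finset.sum_congr rfl fun p _ => Finset.sum_congr rfl fun q _ => ?_
    rw [G.weight_symm q p]
    ring
  rw [hleft, dirichletForm, Finset.sum_product]
  simp only [mul_sub (f _ - f _), mul_sub (G.weight _ _), Finset.sum_sub_distrib] at hright ⊢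
  linarith

theorem energy_eq_dirichletForm {f : Γ → ℝ} (hf : ∀ p ∉ D, f p = 0) :
    G.energy f = G.dirichletForm V f f := by
  rw [dirichletForm_eq_sum_laplacian hV f hf, energy, innerProd]
  refine finsum_eq_sum_of_support_subset _ fun p hp => ?_
  by_contra hpV
  exact hp (by simp only [hf p fun h => hpV (hV (subset_closure D h)), mul_zero, zero_mul])

end DirichletForm

/-- `g` is the Green function `g_D(x, ·)` of the finite set `D` with pole `x ∈ D`, normalized by
`-Δ g_D(x, ·) = δ_x / μ(x)` on `D`, so that it is symmetric in its two variables. -/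
structure IsGreen (G : WeightedGraph Γ) (D : Set Γ) (x : Γ) (g : Γ → ℝ) : Prop where
  finite : D.Finite
  pole_mem : x ∈ D
  eq_zero : ∀ p ∉ D, g p = 0
  laplacian_eq_zero : ∀ p ∈ D, p ≠ x → G.laplacian g p = 0
  laplacian_pole : -G.laplacian g x * G.vertexWeight x = 1

theorem exists_isGreen [Infinite Γ] [G.graph.LocallyFinite] (hc : G.graph.Connected) {D : Set Γ}
    (hD : D.Finite) {x : Γ} (hx : x ∈ D) : ∃ g, G.IsGreen D x g := by
  classical
  obtain ⟨g, hzero, hlap⟩ :=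
    exists_laplacian_eq hc hD hD.infinite_compl.nonempty (Pi.single x (-(G.vertexWeight x)⁻¹))
  refine ⟨g, hD, hx, hzero, fun p hp hpx => ?_, ?_⟩
  · rw [hlap p hp, Pi.single_eq_of_ne hpx]
  · rw [hlap x hx, Pi.single_eq_same, neg_neg, inv_mul_cancel₀ (vertexWeight_pos hc x).ne']

namespace IsGreen

variable {D : Set Γ} {x : Γ} {g : Γ → ℝ} (hg : G.IsGreen D x g)
include hg

theorem laplacian_nonpos {p : Γ} (hp : p ∈ D) : G.laplacian g p ≤ 0 := by
  by_cases hpx : p = x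
  · rw [hpx]
    by_contra! hpos
    nlinarith [hg.laplacian_pole, vertexWeight_nonneg (G := G) x]
  · exact (hg.laplacian_eq_zero p hp hpx).le

section Pairing

variable [G.graph.LocallyFinite]

theorem dirichletForm_eq {V : Finset Γ} (hV : G.closure D ⊆ V) {f : Γ → ℝ}
    (hf : ∀ p ∉ D, f p = 0) : G.dirichletForm V g f = f x := by
  rw [dirichletForm_eq_sum_laplacian hV g hf, Finset.sum_eq_single x]
  · rw [mul_right_comm, hg.laplacian_pole, one_mul]
  · intro p _ hpx
    by_cases hp : p ∈ D
    · rw [hg.laplacian_eq_zero p hp hpx, neg_zero, zero_mul, zero_mul]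
    · rw [hf p hp, mul_zero, zero_mul]
  · exact fun hxV => absurd (hV (subset_closure D hg.pole_mem)) hxV

theorem symm {y : Γ} {g' : Γ → ℝ} (hg' : G.IsGreen D y g') : g y = g' x := by
  have hV : G.closure D ⊆ (finite_closure (G := G) hg.finite).toFinset := by simp
  rw [← hg.dirichletForm_eq hV hg'.eq_zero, ← hg'.dirichletForm_eq hV hg.eq_zero,
    dirichletForm_comm]

theorem dirichletForm_truncation_le {V : Finset Γ} (hV : G.closure D ⊆ V) {c : ℝ} (hc : 0 ≤ c) :
    G.dirichletForm V (fun p => min (g p) c) (fun p => min (g p) c) ≤ c := by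
  have htrunc : G.dirichletForm V (fun p => min (g p) c) (fun p => min (g p) c)
      ≤ G.dirichletForm V g fun p => min (g p) c := dirichletForm_le_of_adj fun p q _ => by
    rcases min_cases (g p) c with ⟨hp, _⟩ | ⟨hp, _⟩ <;>
      rcases min_cases (g q) c with ⟨hq, _⟩ | ⟨hq, _⟩ <;> rw [hp, hq] <;> nlinarith
  rw [hg.dirichletForm_eq hV fun p hp => by simp [hg.eq_zero p hp, hc]] at htrunc
  exact htrunc.trans (min_le_right _ _)

end Pairing

section MaximumPrinciple

variable [Infinite Γ] [G.graph.LocallyFinite] (hc : G.graph.Connected)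
include hc

theorem nonneg (p : Γ) : 0 ≤ g p := by
  by_cases hp : p ∈ D
  · exact minimum_principle hc hg.finite hg.finite.infinite_compl.nonempty
      (fun _ => hg.laplacian_nonpos) (fun q hq => (hg.eq_zero q hq.2).ge) p hp
  · exact (hg.eq_zero p hp).ge

theorem laplacian_nonneg {p : Γ} (hpx : p ≠ x) : 0 ≤ G.laplacian g p := by
  by_cases hp : p ∈ D
  · exact (hg.laplacian_eq_zero p hp hpx).ge
  · rw [laplacian, hg.eq_zero p hp, sub_zero]
    exact tsum_nonneg fun q => mul_nonneg (transition_nonneg p q) (hg.nonneg hc q)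

theorem le_of_sphere {n : ℕ} {M : ℝ} (hM : 0 ≤ M) (hs : ∀ p, G.graph.dist x p = n → g p ≤ M)
    {p : Γ} (hp : n ≤ G.graph.dist x p) : g p ≤ M := by
  by_cases hpD : p ∉ D
  · exact (hg.eq_zero p hpD).trans_le hM
  rcases hp.eq_or_lt with hpn | hpn
  · exact hs p hpn.symm
  have hU : (D ∩ {q | n < G.graph.dist x q}).Finite := hg.finite.inter_of_left _
  refine comparison_principle hc hU hU.infinite_compl.nonempty (v := fun _ => M)
    (fun q hq => ?_) (fun q hq => ?_) p ⟨not_not.1 hpD, hpn⟩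
  · rw [laplacian_const M (vertexWeight_pos hc q)]
    refine hg.laplacian_nonneg hc ?_
    rintro rfl
    exact absurd hq.2 (by simp)
  · by_cases hqD : q ∈ D
    · obtain ⟨r, hr, hadj⟩ := exists_adj_of_mem_closure_diff hq
      have hrn : n < G.graph.dist x r := hr.2
      have hqn : ¬ n < G.graph.dist x q := fun h => hq.2 ⟨hqD, h⟩
      have hstep := dist_le_dist_add_one_of_adj hc x hadj.symm
      exact hs q (by lia)
    · exact (hg.eq_zero q hqD).trans_le hM

theorem le_pole (p : Γ) : g p ≤ g x :=
  hg.le_of_sphere hc (hg.nonneg hc x) (fun q hq => by rw [hc.dist_eq_zero_iff.1 hq])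
    (Nat.zero_le _)

theorem exists_max_on_sphere (n : ℕ) :
    ∃ y, G.graph.dist x y = n ∧ ∀ p, n ≤ G.graph.dist x p → g p ≤ g y := by
  have hfin : {p | G.graph.dist x p = n}.Finite :=
    (finite_setOf_dist_le hc x n).subset fun _ hp => le_of_eq hp
  obtain ⟨y, hy, hmax⟩ := Set.exists_max_image _ g hfin (exists_dist_eq hc x n)
  exact ⟨y, hy, fun _ => hg.le_of_sphere hc (hg.nonneg hc y) hmax⟩

theorem ge_of_sphere {n : ℕ} {m : ℝ} (hn : ∀ p, G.graph.dist x p < n → p ∈ D)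
    (hs : ∀ p, G.graph.dist x p = n → m ≤ g p) {p : Γ} (hp : G.graph.dist x p ≤ n) :
    m ≤ g p := by
  rcases hp.eq_or_lt with hpn | hpn
  · exact hs p hpn
  have hU : {q | G.graph.dist x q < n}.Finite :=
    (finite_setOf_dist_le hc x n).subset fun _ hq => Nat.le_of_lt hq
  refine comparison_principle hc hU hU.infinite_compl.nonempty (u := fun _ => m)
    (fun q hq => ?_) (fun q hq => ?_) p hpn
  · rw [laplacian_const m (vertexWeight_pos hc q)]
    exact hg.laplacian_nonpos (hn q hq)
  · obtain ⟨r, hr, hadj⟩ := exists_adj_of_mem_closure_diff hq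
    have hrn : G.graph.dist x r < n := hr
    have hqn : ¬ G.graph.dist x q < n := hq.2
    have hstep := dist_le_dist_add_one_of_adj hc x hadj
    exact hs q (by lia)

theorem one_le_vertexWeight_mul_pole : 1 ≤ G.vertexWeight x * g x := by
  have hmarkov : 0 ≤ G.markovOp g x :=
    tsum_nonneg fun q => mul_nonneg (transition_nonneg x q) (hg.nonneg hc q)
  have hpole := hg.laplacian_pole
  rw [laplacian, neg_sub] at hpole
  nlinarith [vertexWeight_nonneg (G := G) x]

theorem pole_pos : 0 < g x :=
  pos_of_mul_pos_right (zero_lt_one.trans_le (hg.one_le_vertexWeight_mul_pole hc))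
    (vertexWeight_nonneg x)

end MaximumPrinciple

end IsGreen

section Resistance

theorem resistance_anti {A A' B B' : Set Γ} (hA : A ⊆ A') (hB : B ⊆ B') :
    G.resistance A' B' ≤ G.resistance A B :=
  ENNReal.inv_le_inv.2 <| le_iInf₂ fun f hf =>
    iInf₂_le f ⟨hf.1, fun p hp => hf.2.1 p (hA hp), fun p hp => hf.2.2 p (hB hp)⟩

theorem annulusResistance_mono (x : Γ) {r r' R R' : ℝ} (hr : r' ≤ r) (hR : R ≤ R') :
    G.annulusResistance x r R ≤ G.annulusResistance x r' R' :=
  resistance_anti (ball_subset_ball x hr) (Set.compl_subset_compl.2 (ball_subset_ball x hR))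

variable [G.graph.LocallyFinite] {D : Set Γ} {x : Γ} {g : Γ → ℝ} (hg : G.IsGreen D x g)
include hg

theorem IsGreen.ofReal_le_resistance {A : Set Γ} {m : ℝ} (hm : ∀ p ∈ A, m ≤ g p) :
    ENNReal.ofReal m ≤ G.resistance A Dᶜ := by
  rcases le_or_gt m 0 with hm0 | hm0
  · rw [ENNReal.ofReal_of_nonpos hm0]
    exact zero_le
  have hV : G.closure D ⊆ (finite_closure (G := G) hg.finite).toFinset := by simp
  set f : Γ → ℝ := fun p => m⁻¹ * min (g p) m
  have hf0 : ∀ p ∉ D, f p = 0 := fun p hp => by simp [f, hg.eq_zero p hp, hm0.le]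
  have hf1 : ∀ p ∈ A, f p = 1 := fun p hp => by simp [f, min_eq_right (hm p hp), hm0.ne']
  have henergy : G.energy f ≤ m⁻¹ :=
    calc G.energy f = m⁻¹ ^ 2 * _ := by
          rw [energy_eq_dirichletForm hV hf0, dirichletForm_const_mul]
      _ ≤ m⁻¹ ^ 2 * m :=
          mul_le_mul_of_nonneg_left (hg.dirichletForm_truncation_le hV hm0.le) (sq_nonneg _)
      _ = m⁻¹ := by field_simp
  rw [resistance, ENNReal.le_inv_iff_le_inv, ← ENNReal.ofReal_inv_of_pos hm0]
  refine (iInf₂_le f ⟨hg.finite.subset fun p hp => ?_, hf1, fun p hp => hf0 p hp⟩).trans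
    (ENNReal.ofReal_le_ofReal henergy)
  by_contra hpD
  exact hp (hf0 p hpD)

theorem IsGreen.resistance_le_ofReal {A : Set Γ} (hx : x ∈ A) {M : ℝ} (hM : 0 ≤ M)
    (hgM : ∀ p ∈ G.closure Aᶜ, g p ≤ M) : G.resistance A Dᶜ ≤ ENNReal.ofReal M := by
  have hV : G.closure D ⊆ (finite_closure (G := G) hg.finite).toFinset := by simp
  set V := (finite_closure (G := G) hg.finite).toFinset
  set k : Γ → ℝ := fun p => min (g p) M
  suffices hbound : ∀ f : Γ → ℝ, (∀ p ∈ A, f p = 1) → (∀ p ∉ D, f p = 0) →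
      1 ≤ M * G.energy f by
    rw [resistance, ENNReal.inv_le_iff_inv_le]
    refine le_iInf₂ fun f ⟨_, hf1, hf0⟩ => ?_
    have hf := hbound f hf1 hf0
    have hM0 : 0 < M := hM.lt_of_ne (by rintro rfl; linarith)
    rw [← ENNReal.ofReal_inv_of_pos hM0]
    exact ENNReal.ofReal_le_ofReal ((inv_le_iff_one_le_mul₀' hM0).2 hf)
  intro f hf1 hf0
  have hk : ∀ p ∈ G.closure Aᶜ, k p = g p := fun p hp => min_eq_left (hgM p hp)
  -- `g` may be truncated at `M`, since it exceeds `M` only where `f` is constant.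
  have hpair : G.dirichletForm V k f = 1 := by
    rw [← hf1 x hx, ← hg.dirichletForm_eq hV hf0]
    refine dirichletForm_congr_of_adj fun p q hpq => ?_
    by_cases hp : p ∈ A
    · by_cases hq : q ∈ A
      · rw [hf1 p hp, hf1 q hq, sub_self, mul_zero, mul_zero]
      · rw [hk p (mem_closure_of_adj hq hpq.symm), hk q (subset_closure _ hq)]
    · rw [hk p (subset_closure _ hp), hk q (mem_closure_of_adj hp hpq)]
  calc (1 : ℝ) = G.dirichletForm V k f ^ 2 := by rw [hpair, one_pow]
    _ ≤ G.dirichletForm V k k * G.dirichletForm V f f := sq_dirichletForm_le V k f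
    _ ≤ M * G.dirichletForm V f f :=
        mul_le_mul_of_nonneg_right (hg.dirichletForm_truncation_le hV hM)
          (dirichletForm_self_nonneg V f)
    _ = M * G.energy f := by rw [energy_eq_dirichletForm hV hf0]

end Resistance

theorem le_dist_add_one_of_mem_closure_compl_ball (hc : G.graph.Connected) {x p : Γ} {r : ℝ}
    (hp : p ∈ G.closure (G.ball x r)ᶜ) : r ≤ G.graph.dist x p + 1 := by
  rcases hp with hp | ⟨q, hq, hqp⟩
  · exact (notMem_ball.1 hp).trans (le_add_of_nonneg_right zero_le_one)
  · have hstep : (G.graph.dist x q : ℝ) ≤ G.graph.dist x p + 1 := by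
      exact_mod_cast dist_le_dist_add_one_of_adj hc x hqp.symm
    exact (notMem_ball.1 hq).trans hstep

theorem IsGreen.pos [Infinite Γ] [G.graph.LocallyFinite] (hc : G.graph.Connected) {D : Set Γ}
    {x p : Γ} {g : Γ → ℝ} (hg : G.IsGreen D x g)
    (hD : ∀ q, G.graph.dist x q ≤ G.graph.dist x p → q ∈ D) : 0 < g p := by
  induction hn : G.graph.dist x p generalizing p with
  | zero => exact hc.dist_eq_zero_iff.1 hn ▸ hg.pole_pos hc
  | succ n ih =>
    rw [SimpleGraph.dist_comm] at hn
    obtain ⟨q, hadj, hqx⟩ := exists_adj_dist_add_one_eq hc (hn.trans_ne n.succ_ne_zero)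
    rw [G.graph.dist_comm (v := x)] at hn
    rw [G.graph.dist_comm (u := q), G.graph.dist_comm (u := p)] at hqx
    have hgq : 0 < g q := ih (fun r hr => hD r (by lia)) (by lia)
    refine (hg.nonneg hc p).lt_of_ne fun hgp => hgq.ne' ?_
    rw [hgp]
    exact eq_of_laplacian_nonpos_of_forall_adj_le (hg.laplacian_nonpos (hD p le_rfl))
      (fun r _ => hgp ▸ hg.nonneg hc r) hadj

theorem le_ofReal_mul {a b : ℝ≥0∞} {M m C : ℝ} (ha : a ≤ ENNReal.ofReal M)
    (hb : ENNReal.ofReal m ≤ b) (hC : 0 ≤ C) (h : M ≤ C * m) : a ≤ ENNReal.ofReal C * b :=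
  calc a ≤ ENNReal.ofReal (C * m) := ha.trans (ENNReal.ofReal_le_ofReal h)
    _ = ENNReal.ofReal C * ENNReal.ofReal m := ENNReal.ofReal_mul hC
    _ ≤ ENNReal.ofReal C * b := by gcongr

section SmallScales

variable {p₀ : ℝ} (h0 : ∀ x y, G.graph.Adj x y → p₀ ≤ G.transition x y)
include h0

theorem le_one_of_forall_adj_le_transition [Nontrivial Γ] (hc : G.graph.Connected) (x : Γ) :
    p₀ ≤ 1 :=
  (hc.preconnected.exists_adj_of_nontrivial x).elim fun y hy =>
    (h0 x y hy).trans (transition_le_one x y)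

variable [G.graph.LocallyFinite]

theorem mul_le_markovOp_of_adj {u : Γ → ℝ} (hu : ∀ q, 0 ≤ u q) {p q : Γ}
    (h : G.graph.Adj p q) : p₀ * u q ≤ G.markovOp u p :=
  (mul_le_mul_of_nonneg_right (h0 p q h) (hu q)).trans (transition_mul_le_markovOp hu p q)

variable (hc : G.graph.Connected) (hp₀ : 0 < p₀)
include hc hp₀

theorem pow_dist_mul_le_of_superharmonic {u : Γ → ℝ} (hu : ∀ q, 0 ≤ u q) {a b : Γ}
    (hlap : ∀ p ∈ geodesicInterval G.graph a b, G.laplacian u p ≤ 0) :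
    p₀ ^ G.graph.dist a b * u b ≤ u a := by
  induction hn : G.graph.dist a b generalizing a with
  | zero => rw [hc.dist_eq_zero_iff.1 hn, pow_zero, one_mul]
  | succ n ih =>
    obtain ⟨c, hac, hcb⟩ := exists_adj_dist_add_one_eq hc (hn.trans_ne n.succ_ne_zero)
    have hc_mem : c ∈ geodesicInterval G.graph a b := by
      rw [mem_geodesicInterval, SimpleGraph.dist_eq_one_iff_adj.2 hac, add_comm, hcb]
    calc p₀ ^ (n + 1) * u b = p₀ * (p₀ ^ n * u b) := by ring
      _ ≤ p₀ * u c := mul_le_mul_of_nonneg_left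
        (ih (fun p hp => hlap p (geodesicInterval_subset_of_mem hc hc_mem hp)) (by lia)) hp₀.le
      _ ≤ G.markovOp u a := mul_le_markovOp_of_adj h0 hu hac
      _ ≤ u a := sub_nonpos.1 (hlap a (left_mem_geodesicInterval a b))

variable [Infinite Γ]

theorem IsGreen.pow_dist_mul_pole_le {D : Set Γ} {x p : Γ} {g : Γ → ℝ} (hg : G.IsGreen D x g)
    (hD : ∀ q, G.graph.dist x q ≤ G.graph.dist x p → q ∈ D) :
    p₀ ^ G.graph.dist x p * g x ≤ g p := by
  rw [SimpleGraph.dist_comm]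
  refine pow_dist_mul_le_of_superharmonic h0 hc hp₀ (hg.nonneg hc) fun q hq =>
    hg.laplacian_nonpos (hD q ?_)
  rw [geodesicInterval_comm, mem_geodesicInterval] at hq
  lia

theorem IsGreen.pow_dist_mul_pole_le_one {D : Set Γ} {x w : Γ} {g : Γ → ℝ}
    (hg : G.IsGreen D x g) (hw : w ∉ D) :
    p₀ ^ G.graph.dist x w * (G.vertexWeight x * g x) ≤ 1 := by
  have hxw : G.graph.dist x w ≠ 0 := fun h => hw (hc.dist_eq_zero_iff.1 h ▸ hg.pole_mem)
  obtain ⟨y, hxy, hyw⟩ := exists_adj_dist_add_one_eq hc hxw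
  have hμ : ∀ p, 0 < G.vertexWeight p := vertexWeight_pos hc
  set v : Γ → ℝ := fun q => g x - g q
  have hv : ∀ q, 0 ≤ v q := fun q => sub_nonneg.2 (hg.le_pole hc q)
  have hgeod : p₀ ^ G.graph.dist y w * g x ≤ v y := by
    have hsuper := pow_dist_mul_le_of_superharmonic h0 hc hp₀ hv (a := y) (b := w) fun p hp => by
      have hpx : p ≠ x := by
        rintro rfl
        rw [mem_geodesicInterval, SimpleGraph.dist_comm] at hp
        lia
      rw [laplacian_const_sub _ _ (hμ p)]
      exact neg_nonpos.2 (hg.laplacian_nonneg hc hpx)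
    rwa [show v w = g x by simp [v, hg.eq_zero w hw]] at hsuper
  have hpole : G.markovOp v x = -G.laplacian g x := by
    rw [← laplacian_const_sub (g x) g (hμ x), laplacian, sub_self, sub_zero]
  calc p₀ ^ G.graph.dist x w * (G.vertexWeight x * g x)
      = p₀ * (p₀ ^ G.graph.dist y w * g x) * G.vertexWeight x := by
        rw [← hyw]
        ring
    _ ≤ G.markovOp v x * G.vertexWeight x := by
        refine mul_le_mul_of_nonneg_right ?_ (hμ x).le
        exact (mul_le_mul_of_nonneg_left hgeod hp₀.le).trans
          (mul_le_markovOp_of_adj h0 hv hxy)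
    _ = 1 := by rw [hpole, hg.laplacian_pole]

theorem ofReal_le_annulusResistance_of_le {x : Γ} {r R : ℝ} (hr : 0 < r) (hrR : r ≤ R) {N : ℕ}
    (hN : R ≤ N) : ENNReal.ofReal (p₀ ^ N / G.vertexWeight x) ≤ G.annulusResistance x r R := by
  obtain ⟨g, hg⟩ := exists_isGreen hc (finite_ball hc x R) (mem_ball_self (hr.trans_le hrR))
  refine hg.ofReal_le_resistance fun p hp => ?_
  have hpR : (G.graph.dist x p : ℝ) < R := (mem_ball.1 hp).trans_le hrR
  have hpN : G.graph.dist x p ≤ N := by exact_mod_cast hpR.le.trans hN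
  calc p₀ ^ N / G.vertexWeight x ≤ p₀ ^ N * g x := by
        rw [div_le_iff₀ (vertexWeight_pos hc x), mul_assoc, mul_comm (g x)]
        exact le_mul_of_one_le_right (by positivity) (hg.one_le_vertexWeight_mul_pole hc)
    _ ≤ p₀ ^ G.graph.dist x p * g x := mul_le_mul_of_nonneg_right
        (pow_le_pow_of_le_one hp₀.le (le_one_of_forall_adj_le_transition h0 hc x) hpN)
        (hg.nonneg hc x)
    _ ≤ g p := hg.pow_dist_mul_pole_le h0 hc hp₀ fun q hq =>
        lt_of_le_of_lt (Nat.cast_le.2 hq) hpR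

theorem annulusResistance_le_ofReal_of_le {x : Γ} {r R : ℝ} (hr : 0 < r) (hR : 0 < R) {N : ℕ}
    (hN : R ≤ N) :
    G.annulusResistance x r R ≤ ENNReal.ofReal (p₀ ^ N * G.vertexWeight x)⁻¹ := by
  obtain ⟨g, hg⟩ := exists_isGreen hc (finite_ball hc x R) (mem_ball_self hR)
  refine (hg.resistance_le_ofReal (mem_ball_self hr) (hg.nonneg hc x)
    fun p _ => hg.le_pole hc p).trans (ENNReal.ofReal_le_ofReal ?_)
  obtain ⟨w, hw⟩ := exists_dist_eq hc x N
  have hone := hg.pow_dist_mul_pole_le_one h0 hc hp₀ (w := w) (notMem_ball.2 (hw ▸ hN))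
  rw [hw, ← mul_assoc] at hone
  exact (le_inv_mul_iff₀ (mul_pos (pow_pos hp₀ N) (vertexWeight_pos hc x))).2 hone |>.trans_eq
    (mul_one _)

theorem annulusResistance_le_mul_of_le {x : Γ} {r R r' R' : ℝ} (hr : 0 < r) (hR : 0 < R)
    (hr' : 0 < r') (hrR' : r' ≤ R') {N : ℕ} (hN : R ≤ N) (hN' : R' ≤ N) :
    G.annulusResistance x r R
      ≤ ENNReal.ofReal (p₀ ^ (2 * N))⁻¹ * G.annulusResistance x r' R' := by
  have hμ := vertexWeight_pos hc x
  refine le_ofReal_mul (annulusResistance_le_ofReal_of_le h0 hc hp₀ hr hR hN)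
    (ofReal_le_annulusResistance_of_le h0 hc hp₀ hr' hrR' hN') (by positivity) (le_of_eq ?_)
  field_simp
  ring

end SmallScales

/-- The elliptic Harnack inequality with the constant `H` explicit, for tracking constants. -/
def HarnackWith (G : WeightedGraph Γ) (H : ℝ) : Prop :=
  ∀ (x : Γ) (R : ℝ), 0 < R → ∀ u : Γ → ℝ,
    G.HarmonicOn u (G.ball x (2 * R)) →
    (∀ y ∈ G.closure (G.ball x (2 * R)), 0 ≤ u y) →
    ∀ y ∈ G.ball x R, ∀ z ∈ G.ball x R, u y ≤ H * u z

section Harnack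

variable {H : ℝ} (hH : G.HarnackWith H) {s : ℕ}
include hH

theorem HarnackWith.le_of_dist_le {u : Γ → ℝ} (hpos : ∀ q, 0 ≤ u q) {p : Γ}
    (hu : ∀ q, G.graph.dist p q ≤ 2 * s → G.laplacian u q = 0) {y z : Γ}
    (hy : G.graph.dist p y ≤ s) (hz : G.graph.dist p z ≤ s) : u y ≤ H * u z := by
  have hball : ∀ q, G.graph.dist p q ≤ s → q ∈ G.ball p (s + 1 / 2) := fun q hq => by
    have hq' : (G.graph.dist p q : ℝ) ≤ s := Nat.cast_le.2 hq
    rw [mem_ball]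
    linarith
  refine hH p (s + 1 / 2) (by positivity) u (fun q hq => sub_eq_zero.1 (hu q ?_))
    (fun q _ => hpos q) y (hball y hy) z (hball z hz)
  have hq' : (G.graph.dist p q : ℝ) < (2 * s + 1 : ℕ) := by
    push_cast
    linarith [mem_ball.1 hq]
  exact Nat.lt_succ_iff.1 (Nat.cast_lt.1 hq')

variable [Nontrivial Γ] [G.graph.LocallyFinite] (hc : G.graph.Connected)
include hc

theorem HarnackWith.one_le : 1 ≤ H := by
  obtain ⟨x⟩ := hc.nonempty
  simpa using hH.le_of_dist_le (s := 0) (u := fun _ => 1) (fun _ => zero_le_one)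
    (fun q _ => laplacian_const 1 (vertexWeight_pos hc q)) (p := x) (y := x) (z := x)

theorem HarnackWith.le_pow_mul {u : Γ → ℝ} (hpos : ∀ q, 0 ≤ u q) {N : ℕ} {a b : Γ}
    (hab : G.graph.dist a b ≤ N * s)
    (hu : ∀ p ∈ geodesicInterval G.graph a b, ∀ q, G.graph.dist p q ≤ 2 * s →
      G.laplacian u q = 0) : u a ≤ H ^ N * u b := by
  have hH1 := hH.one_le hc
  induction N generalizing a with
  | zero => rw [hc.dist_eq_zero_iff.1 (by lia : G.graph.dist a b = 0), pow_zero, one_mul]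
  | succ N ih =>
    obtain ⟨c, hac, hdist⟩ := exists_mem_geodesicInterval_dist_eq hc
      (min_le_right s (G.graph.dist a b))
    have hcb : G.graph.dist c b ≤ N * s := by
      rw [mem_geodesicInterval] at hac
      lia
    calc u a ≤ H * u c := hH.le_of_dist_le hpos (hu a (left_mem_geodesicInterval a b))
          (by simp) (hdist.trans_le (min_le_left _ _))
      _ ≤ H * (H ^ N * u b) := by
          gcongr
          exact ih hcb fun p hp => hu p (geodesicInterval_subset_of_mem hc hac hp)
      _ = H ^ (N + 1) * u b := by ring

end Harnack

namespace IsGreen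

section AnnulusHarnack

variable [Infinite Γ] [G.graph.LocallyFinite] {H : ℝ} (hH : G.HarnackWith H)
  (hc : G.graph.Connected) {D : Set Γ} {x : Γ} {g : Γ → ℝ} (hg : G.IsGreen D x g) {s : ℕ}
include hH hc hg

theorem le_pow_mul_of_far_pole {N : ℕ} {a b : Γ} (hab : G.graph.dist a b ≤ N * s)
    (hfar : ∀ p ∈ geodesicInterval G.graph a b, 2 * s < G.graph.dist x p)
    (hD : ∀ p ∈ geodesicInterval G.graph a b, ∀ q, G.graph.dist p q ≤ 2 * s → q ∈ D) :
    g a ≤ H ^ N * g b := by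
  refine hH.le_pow_mul hc (hg.nonneg hc) hab fun p hp q hpq =>
    hg.laplacian_eq_zero q (hD p hp q hpq) ?_
  rintro rfl
  rw [SimpleGraph.dist_comm] at hpq
  exact (hfar p hp).not_ge hpq

theorem exists_on_sphere_comparable (hs : 0 < s) {n N : ℕ} (hn : n ≤ (9 + N) * s)
    (hD : ∀ p, G.graph.dist x p ≤ n + 2 * s → p ∈ D) {y : Γ} (hy : 9 * s ≤ G.graph.dist x y)
    (hyn : G.graph.dist x y ≤ n) :
    ∃ y', G.graph.dist x y' = 9 * s ∧ g y ≤ H ^ N * g y' ∧ g y' ≤ H ^ N * g y := by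
  obtain ⟨y', hy', hxy'⟩ := exists_mem_geodesicInterval_dist_eq hc hy
  rw [mem_geodesicInterval] at hy'
  have hy'y : G.graph.dist y' y ≤ N * s := by lia
  have hannulus : ∀ p ∈ geodesicInterval G.graph y' y,
      9 * s ≤ G.graph.dist x p ∧ G.graph.dist x p ≤ n := fun p hp => by
    have hxy'p := hc.dist_triangle (u := x) (v := y') (w := p)
    have hxpy := hc.dist_triangle (u := x) (v := p) (w := y)
    rw [mem_geodesicInterval] at hp
    lia
  have hfar : ∀ p ∈ geodesicInterval G.graph y' y, 2 * s < G.graph.dist x p := fun p hp => by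
    have := (hannulus p hp).1
    lia
  have hD' : ∀ p ∈ geodesicInterval G.graph y' y, ∀ q, G.graph.dist p q ≤ 2 * s → q ∈ D :=
    fun p hp q hpq => hD q (hc.dist_triangle.trans (Nat.add_le_add (hannulus p hp).2 hpq))
  refine ⟨y', hxy', ?_, hg.le_pow_mul_of_far_pole hH hc hy'y hfar hD'⟩
  rw [SimpleGraph.dist_comm] at hy'y
  rw [geodesicInterval_comm] at hfar hD'
  exact hg.le_pow_mul_of_far_pole hH hc hy'y hfar hD'

theorem le_of_sphere_of_dist_le (hs : 0 < s)
    (hD : ∀ p, G.graph.dist x p ≤ 17 * s → p ∈ D) {y z : Γ}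
    (hy : G.graph.dist x y = 9 * s) (hyz : G.graph.dist y z ≤ 4 * s) : g y ≤ H * g z := by
  refine hH.le_of_dist_le (hg.nonneg hc) (p := y) (fun q hq => ?_) (by simp) hyz
  have hxq := hc.dist_triangle (u := x) (v := y) (w := q)
  refine hg.laplacian_eq_zero q (hD q (by lia)) ?_
  rintro rfl
  rw [SimpleGraph.dist_comm] at hq
  lia

theorem le_pow_mul_of_sphere (hs : 0 < s) (hD : ∀ p, G.graph.dist x p ≤ 17 * s → p ∈ D)
    {y z : Γ} (hy : G.graph.dist x y = 9 * s) (hz : G.graph.dist x z = 9 * s) :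
    g y ≤ H ^ 18 * g z := by
  have hH1 := hH.one_le hc
  have hclose : G.graph.dist y z ≤ 4 * s → g y ≤ H ^ 18 * g z := fun hyz =>
    (hg.le_of_sphere_of_dist_le hH hc hs hD hy hyz).trans
      (mul_le_mul_of_nonneg_right (le_self_pow₀ hH1 (by norm_num)) (hg.nonneg hc z))
  by_cases! hyfar : ∃ p ∈ geodesicInterval G.graph x z, G.graph.dist y p ≤ 2 * s
  · obtain ⟨p, hp, hyp⟩ := hyfar
    have hyz := dist_le_two_mul_of_mem_geodesicInterval hc hp hyp (by lia)
    exact hclose (by lia)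
  by_cases! hzfar : ∃ p ∈ geodesicInterval G.graph x y, G.graph.dist z p ≤ 2 * s
  · obtain ⟨p, hp, hzp⟩ := hzfar
    have hzy := dist_le_two_mul_of_mem_geodesicInterval hc hp hzp (by lia)
    rw [SimpleGraph.dist_comm] at hzy
    exact hclose (by lia)
  have hD' : ∀ w, G.graph.dist x w = 9 * s → ∀ p ∈ geodesicInterval G.graph x w,
      ∀ q, G.graph.dist p q ≤ 2 * s → q ∈ D := fun w hw p hp q hpq => by
    have hxpq := hc.dist_triangle (u := x) (v := p) (w := q)
    rw [mem_geodesicInterval] at hp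
    exact hD q (by lia)
  obtain ⟨gy, hgy⟩ := exists_isGreen hc hg.finite (hD y (by lia))
  obtain ⟨gz, hgz⟩ := exists_isGreen hc hg.finite (hD z (by lia))
  have hyx : G.graph.dist y x ≤ 9 * s := by rw [SimpleGraph.dist_comm, hy]
  have hgz_le : gz y ≤ H ^ 9 * gz x := hgz.le_pow_mul_of_far_pole hH hc hyx
    (by rwa [geodesicInterval_comm]) (by simpa only [geodesicInterval_comm y x] using hD' y hy)
  calc g y = gy x := hg.symm hgy
    _ ≤ H ^ 9 * gy z := hgy.le_pow_mul_of_far_pole hH hc hz.le hyfar (hD' z hz)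
    _ = H ^ 9 * gz y := by rw [hgy.symm hgz]
    _ ≤ H ^ 9 * (H ^ 9 * gz x) := by gcongr
    _ = H ^ 18 * g z := by rw [hg.symm hgz]; ring

theorem le_pow_mul_of_annulus (hs : 0 < s) {n N : ℕ} (hsn : 15 * s ≤ n) (hn : n ≤ (9 + N) * s)
    (hD : ∀ p, G.graph.dist x p ≤ n + 2 * s → p ∈ D) {y z : Γ}
    (hy : 9 * s ≤ G.graph.dist x y) (hyn : G.graph.dist x y ≤ n)
    (hz : 9 * s ≤ G.graph.dist x z) (hzn : G.graph.dist x z ≤ n) :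
    g y ≤ H ^ (2 * N + 18) * g z := by
  have hH1 := hH.one_le hc
  obtain ⟨y', hxy', hyy', -⟩ := hg.exists_on_sphere_comparable hH hc hs hn hD hy hyn
  obtain ⟨z', hxz', -, hz'z⟩ := hg.exists_on_sphere_comparable hH hc hs hn hD hz hzn
  calc g y ≤ H ^ N * g y' := hyy'
    _ ≤ H ^ N * (H ^ 18 * g z') := by
        gcongr
        exact hg.le_pow_mul_of_sphere hH hc hs (fun p hp => hD p (by lia)) hxy' hxz'
    _ ≤ H ^ N * (H ^ 18 * (H ^ N * g z)) := by gcongr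
    _ = H ^ (2 * N + 18) * g z := by ring

end AnnulusHarnack

end IsGreen

section LargeScales

theorem IsGreen.laplacian_eq_of_subset {D D' : Set Γ} {x p : Γ} {g g' : Γ → ℝ}
    (hg : G.IsGreen D x g) (hg' : G.IsGreen D' x g') (hsub : D' ⊆ D) (hp : p ∈ D') :
    G.laplacian g p = G.laplacian g' p := by
  by_cases hpx : p = x
  · have hpole := hg.laplacian_pole.trans hg'.laplacian_pole.symm
    have hμ : G.vertexWeight x ≠ 0 := fun h => by simpa [h] using hg.laplacian_pole
    rw [hpx]
    exact neg_injective (mul_right_cancel₀ hμ hpole)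
  · rw [hg.laplacian_eq_zero p (hsub hp) hpx, hg'.laplacian_eq_zero p hp hpx]

variable [Infinite Γ] [G.graph.LocallyFinite]

theorem IsGreen.annulusResistance_le_ofReal (hc : G.graph.Connected) {x : Γ} {r R : ℝ}
    {g : Γ → ℝ} (hg : G.IsGreen (G.ball x R) x g) (hr : 0 < r) {n : ℕ} (hn : (n : ℝ) + 1 ≤ r)
    {y : Γ} (hgy : ∀ p, n ≤ G.graph.dist x p → g p ≤ g y) :
    G.annulusResistance x r R ≤ ENNReal.ofReal (g y) := by
  refine hg.resistance_le_ofReal (mem_ball_self hr) (hg.nonneg hc y) fun p hp => hgy p ?_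
  have hnp : (n : ℝ) ≤ G.graph.dist x p := by
    linarith [le_dist_add_one_of_mem_closure_compl_ball hc hp]
  exact_mod_cast hnp

variable {H : ℝ} (hH : G.HarnackWith H) (hc : G.graph.Connected)
include hH hc

theorem IsGreen.ofReal_le_annulusResistance {x y : Γ} {r R : ℝ} {g : Γ → ℝ}
    (hg : G.IsGreen (G.ball x R) x g) {s N : ℕ} (hs : 0 < s) (hsr : 15 * s ≤ r)
    (hr : r ≤ (9 + N) * s) (hR : r + 2 * s + 1 ≤ R) (hy : G.graph.dist x y = 9 * s) :
    ENNReal.ofReal ((H ^ (2 * N + 18))⁻¹ * g y) ≤ G.annulusResistance x r R := by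
  have hH1 := hH.one_le hc
  have hr0 : 0 ≤ r := le_trans (by positivity) hsr
  have hsn : 15 * s ≤ ⌈r⌉₊ := by
    exact_mod_cast (show ((15 * s : ℕ) : ℝ) ≤ r by exact_mod_cast hsr).trans (Nat.le_ceil r)
  have hD : ∀ p, G.graph.dist x p ≤ ⌈r⌉₊ + 2 * s → p ∈ G.ball x R := fun p hp => by
    have hp' : (G.graph.dist x p : ℝ) ≤ ⌈r⌉₊ + 2 * s := by exact_mod_cast hp
    rw [mem_ball]
    linarith [Nat.ceil_lt_add_one hr0]
  refine hg.ofReal_le_resistance fun p hp =>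
    hg.ge_of_sphere hc (n := ⌈r⌉₊) (fun q hq => hD q (by lia)) (fun q hq => ?_)
      (Nat.lt_ceil.2 (mem_ball.1 hp)).le
  refine (inv_mul_le_iff₀ (by positivity)).2 ?_
  exact hg.le_pow_mul_of_annulus hH hc hs hsn (Nat.ceil_le.2 (by exact_mod_cast hr)) hD hy.ge
    (by lia) (by lia) hq.le

theorem HarnackWith.le_pow_mul_of_superharmonic {w p : Γ} {n s N : ℕ} (hs : 0 < s)
    (hsn : 15 * s ≤ n) (hn : n ≤ (9 + N) * s) {v : Γ → ℝ} {m : ℝ} (hm : 0 ≤ m)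
    (hlap : ∀ q, 9 * s < G.graph.dist w q → G.graph.dist w q ≤ n + 2 * s → G.laplacian v q ≤ 0)
    (hinner : ∀ q, G.graph.dist w q = 9 * s → m ≤ v q)
    (houter : ∀ q, G.graph.dist w q = n + 2 * s + 1 → 0 ≤ v q)
    (hp : 9 * s < G.graph.dist w p) (hpn : G.graph.dist w p ≤ n) :
    m ≤ H ^ (2 * N + 18) * v p := by
  have hH1 := hH.one_le hc
  obtain ⟨k, hk⟩ := exists_isGreen hc (finite_setOf_dist_le hc w (n + 2 * s)) (x := w)
    (by simp)
  have hkp : 0 < k p := hk.pos hc fun q hq => hq.trans (by lia)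
  have hU : {q | 9 * s < G.graph.dist w q ∧ G.graph.dist w q ≤ n + 2 * s}.Finite :=
    (finite_setOf_dist_le hc w (n + 2 * s)).subset fun q hq => hq.2
  have hcompare : m * k p ≤ H ^ (2 * N + 18) * k p * v p := by
    refine comparison_principle hc hU hU.infinite_compl.nonempty (u := fun q => m * k q)
      (v := fun q => H ^ (2 * N + 18) * k p * v q) (fun q hq => ?_) (fun q hq => ?_) p
      ⟨hp, by lia⟩
    · have hqw : q ≠ w := by
        rintro rfl
        exact absurd hq.1 (by simp)
      rw [laplacian_const_mul, laplacian_const_mul, hk.laplacian_eq_zero q hq.2 hqw, mul_zero]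
      exact mul_nonpos_of_nonneg_of_nonpos (by positivity) (hlap q hq.1 hq.2)
    · obtain ⟨r, ⟨hr, hr'⟩, hadj⟩ := exists_adj_of_mem_closure_diff hq
      have hrq := dist_le_dist_add_one_of_adj hc w hadj
      have hqr := dist_le_dist_add_one_of_adj hc w hadj.symm
      by_cases hqn : G.graph.dist w q ≤ n + 2 * s
      · have hqs : ¬ 9 * s < G.graph.dist w q := fun h => hq.2 ⟨h, hqn⟩
        have hkq : k q ≤ H ^ (2 * N + 18) * k p := hk.le_pow_mul_of_annulus hH hc hs hsn hn
          (fun _ h => h) (by lia) (by lia) hp.le hpn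
        rw [mul_comm m]
        exact mul_le_mul hkq (hinner q (by lia)) hm (by positivity)
      · rw [hk.eq_zero q hqn, mul_zero]
        exact mul_nonneg (by positivity) (houter q (by lia))
  refine le_of_mul_le_mul_right (hcompare.trans_eq ?_) hkp
  ring

theorem IsGreen.exists_drop {D : Set Γ} {x : Γ} {g : Γ → ℝ} (hg : G.IsGreen D x g) {s N : ℕ}
    (hs : 0 < s) (hN : 18 ≤ N) (hD : ∀ p ∈ D, G.graph.dist x p < N * s) {M : ℝ}
    (hgM : ∀ p, 9 * s ≤ G.graph.dist x p → g p ≤ M) :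
    ∃ z, G.graph.dist x z = 12 * s ∧ M ≤ H ^ (2 * N + 18) * (M - g z) := by
  have hNs : 18 * s ≤ N * s := Nat.mul_le_mul_right s hN
  obtain ⟨w, hw⟩ := exists_dist_eq hc x (N * s + 9 * s)
  obtain ⟨z, hz, hxz⟩ :=
    exists_mem_geodesicInterval_dist_eq hc (a := x) (b := w) (k := 12 * s) (by lia)
  rw [mem_geodesicInterval, G.graph.dist_comm (u := z)] at hz
  have hxw : ∀ q, N * s + 9 * s ≤ G.graph.dist x q + G.graph.dist w q := fun q => by
    rw [← hw, G.graph.dist_comm (u := w)]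
    exact hc.dist_triangle
  have hg0 : ∀ q, N * s ≤ G.graph.dist x q → g q = 0 := fun q hq =>
    hg.eq_zero q fun h => (hD q h).not_ge hq
  have hM : 0 ≤ M := (hg0 w (by lia)).ge.trans (hgM w (by lia))
  refine ⟨z, hxz, hH.le_pow_mul_of_superharmonic hc (w := w) (n := G.graph.dist w z) hs (by lia)
    (by lia) (v := fun q => M - g q) hM (fun q _ hq => ?_) (fun q hq => ?_) (fun q hq => ?_)
    (by lia) le_rfl⟩
  · have hqx : q ≠ x := by
      rintro rfl
      have := hxw q
      rw [SimpleGraph.dist_self] at this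
      lia
    rw [laplacian_const_sub M g (vertexWeight_pos hc q)]
    exact neg_nonpos.2 (hg.laplacian_nonneg hc hqx)
  · have hqw := hxw q
    rw [hg0 q (by lia), sub_zero]
  · have hqw := hxw q
    exact sub_nonneg.2 (hgM q (by lia))

theorem IsGreen.le_pow_mul_of_subset {D D' : Set Γ} {x y : Γ} {g g' : Γ → ℝ}
    (hg : G.IsGreen D x g) (hg' : G.IsGreen D' x g') (hsub : D' ⊆ D) {s N : ℕ} (hs : 0 < s)
    (hN : 18 ≤ N) (hD : ∀ p ∈ D, G.graph.dist x p < N * s)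
    (hD' : ∀ p, G.graph.dist x p ≤ 24 * s → p ∈ D') (hy : G.graph.dist x y = 9 * s)
    (hmax : ∀ p, 9 * s ≤ G.graph.dist x p → g p ≤ g y) :
    g y ≤ H ^ (2 * N + 19) * g' y := by
  have hH1 := hH.one_le hc
  obtain ⟨z, hz, hdrop⟩ := hg.exists_drop hH hc hs hN hD hmax
  -- `u` is harmonic on all of `D'`, since the singularities of `g` and `g'` at `x` cancel.
  set u : Γ → ℝ := fun q => g y - (g q - g' q)
  have hlap : ∀ q ∈ D', G.laplacian u q = 0 := fun q hq => by
    rw [laplacian_const_sub _ _ (vertexWeight_pos hc q), laplacian_sub,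
      hg.laplacian_eq_of_subset hg' hsub hq, sub_self, neg_zero]
  have hout : ∀ q ∉ D', 0 ≤ u q := fun q hq => by
    have hxq : ¬ G.graph.dist x q ≤ 24 * s := fun h => hq (hD' q h)
    have hgq := hmax q (by lia)
    simp only [u, hg'.eq_zero q hq]
    linarith
  have hpos : ∀ q, 0 ≤ u q := fun q => by
    by_cases hq : q ∈ D'
    · exact minimum_principle hc hg'.finite hg'.finite.infinite_compl.nonempty
        (fun p hp => (hlap p hp).le) (fun p hp => hout p hp.2) q hq
    · exact hout q hq
  have hharnack : u z ≤ H * u y := hH.le_of_dist_le hpos (p := x) (s := 12 * s)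
    (fun q hq => hlap q (hD' q (by lia))) hz.le (by lia)
  have hgz : g y - g z ≤ H * g' y :=
    calc g y - g z ≤ u z := by linarith [hg'.nonneg hc z]
      _ ≤ H * u y := hharnack
      _ = H * g' y := by simp only [u]; ring
  calc g y ≤ H ^ (2 * N + 18) * (g y - g z) := hdrop
    _ ≤ H ^ (2 * N + 18) * (H * g' y) := by gcongr
    _ = H ^ (2 * N + 19) * g' y := by ring

variable {x : Γ} {R : ℝ} {s : ℕ} (hs : 0 < s) (hsR : 16 * s ≤ R) (hRs : R ≤ 32 * s)
include hs hsR hRs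

theorem annulusResistance_le_inner :
    G.annulusResistance x R (4 * R)
      ≤ ENNReal.ofReal (H ^ 274) * G.annulusResistance x (2 * R) (4 * R) := by
  have hH1 := hH.one_le hc
  have hs1 : (1 : ℝ) ≤ s := by exact_mod_cast hs
  obtain ⟨g, hg⟩ := exists_isGreen hc (finite_ball hc x (4 * R)) (mem_ball_self (by linarith))
  obtain ⟨y, hy, hmax⟩ := hg.exists_max_on_sphere hc (9 * s)
  refine le_ofReal_mul
    (hg.annulusResistance_le_ofReal hc (by linarith) (by push_cast; linarith) hmax)
    (hg.ofReal_le_annulusResistance hH hc (N := 128) hs (by linarith) (by push_cast; linarith)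
      (by linarith) hy) (by positivity) (le_of_eq ?_)
  field_simp

theorem annulusResistance_le_outer :
    G.annulusResistance x R (4 * R)
      ≤ ENNReal.ofReal (H ^ 549) * G.annulusResistance x R (2 * R) := by
  have hH1 := hH.one_le hc
  have hs1 : (1 : ℝ) ≤ s := by exact_mod_cast hs
  obtain ⟨g, hg⟩ := exists_isGreen hc (finite_ball hc x (4 * R)) (mem_ball_self (by linarith))
  obtain ⟨g', hg'⟩ := exists_isGreen hc (finite_ball hc x (2 * R)) (mem_ball_self (by linarith))
  obtain ⟨y, hy, hmax⟩ := hg.exists_max_on_sphere hc (9 * s)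
  have hD : ∀ p ∈ G.ball x (4 * R), G.graph.dist x p < 128 * s := fun p hp => by
    have hp' : (G.graph.dist x p : ℝ) < 128 * s := by linarith [mem_ball.1 hp]
    exact_mod_cast hp'
  have hD' : ∀ p, G.graph.dist x p ≤ 24 * s → p ∈ G.ball x (2 * R) := fun p hp => by
    have hp' : (G.graph.dist x p : ℝ) ≤ 24 * s := by exact_mod_cast hp
    rw [mem_ball]
    linarith
  have hgg' : g y ≤ H ^ (2 * 128 + 19) * g' y := hg.le_pow_mul_of_subset hH hc hg'
    (ball_subset_ball x (by linarith)) hs (by norm_num) hD hD' hy hmax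
  refine le_ofReal_mul
    (hg.annulusResistance_le_ofReal hc (by linarith) (by push_cast; linarith) hmax)
    (hg'.ofReal_le_annulusResistance hH hc (N := 128) hs (by linarith) (by push_cast; linarith)
      (by linarith) hy) (by positivity) (hgg'.trans_eq ?_)
  rw [show H ^ 549 = H ^ (2 * 128 + 19) * H ^ (2 * 128 + 18) by rw [← pow_add], mul_assoc,
    mul_inv_cancel_left₀ (by positivity)]

end LargeScales

section Comparison

variable [Infinite Γ] (hc : G.graph.Connected) (hp0 : G.CondP0) (hH : G.EllipticHarnack)
include hc hp0 hH

theorem exists_annulusResistance_le :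
    ∃ C : ℝ, 1 ≤ C ∧ ∀ (x : Γ) (R : ℝ), 0 < R →
      G.annulusResistance x R (4 * R)
        ≤ ENNReal.ofReal C * G.annulusResistance x (2 * R) (4 * R) ∧
      G.annulusResistance x R (4 * R)
        ≤ ENNReal.ofReal C * G.annulusResistance x R (2 * R) := by
  obtain ⟨p₀, hp₀, h0⟩ := hp0
  obtain ⟨H, hH1, hH⟩ := hH
  let _ : G.graph.LocallyFinite := fun x => (finite_neighborSet hp₀ (h0 x)).fintype
  refine ⟨max (p₀ ^ (2 * 64))⁻¹ (H ^ 549), le_max_of_le_right (one_le_pow₀ hH1.le),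
    fun x R hR => ?_⟩
  have hweaken : ∀ {a b : ℝ≥0∞} {c : ℝ}, a ≤ ENNReal.ofReal c * b →
      c ≤ max (p₀ ^ (2 * 64))⁻¹ (H ^ 549) →
      a ≤ ENNReal.ofReal (max (p₀ ^ (2 * 64))⁻¹ (H ^ 549)) * b :=
    fun h hle => h.trans (by gcongr)
  rcases le_total R 16 with hR16 | hR16
  · constructor <;>
    exact hweaken (annulusResistance_le_mul_of_le h0 hc hp₀ (by linarith) (by linarith)
      (by linarith) (by linarith) (by push_cast; linarith) (by push_cast; linarith))
      (le_max_left _ _)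
  · have hs : 0 < ⌊R / 16⌋₊ := Nat.floor_pos.2 (by linarith)
    have hs1 : (1 : ℝ) ≤ ⌊R / 16⌋₊ := by exact_mod_cast hs
    have hfloor := Nat.floor_le (show 0 ≤ R / 16 by positivity)
    have hfloor' := Nat.lt_floor_add_one (R / 16)
    exact ⟨hweaken (annulusResistance_le_inner hH hc hs (by linarith) (by linarith))
        (le_max_of_le_right (pow_le_pow_right₀ hH1.le (by norm_num))),
      hweaken (annulusResistance_le_outer hH hc hs (by linarith) (by linarith))
        (le_max_right _ _)⟩

end Comparison

theorem ofReal_one_div_mul_le {a b : ℝ≥0∞} {C : ℝ} (hC : 0 < C)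
    (h : a ≤ ENNReal.ofReal C * b) : ENNReal.ofReal (1 / C) * a ≤ b := by
  rw [one_div, ENNReal.ofReal_inv_of_pos hC, mul_comm, ← div_eq_mul_inv]
  exact ENNReal.div_le_of_le_mul' h

end WeightedGraph

theorem mainTheorem9_general {Γ : Type*} [Infinite Γ] (G : WeightedGraph Γ)
    (hconn : G.graph.Connected) (hp0 : G.CondP0) (hH : G.EllipticHarnack) :
    ∃ C : ℝ, 1 < C ∧ ∀ (x : Γ) (R : ℝ), 0 < R →
      G.annulusResistance x R (4 * R)
          ≤ ENNReal.ofReal C * G.annulusResistance x (2 * R) (4 * R) ∧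
      G.annulusResistance x R (2 * R)
          ≤ ENNReal.ofReal (C - 1) * G.annulusResistance x (2 * R) (4 * R) ∧
      G.annulusResistance x R (4 * R)
          ≤ ENNReal.ofReal C * G.annulusResistance x R (2 * R) ∧
      G.annulusResistance x (2 * R) (4 * R)
          ≤ ENNReal.ofReal (C - 1) * G.annulusResistance x R (2 * R) ∧
      ENNReal.ofReal (1 / (C - 1)) * G.annulusResistance x (2 * R) (4 * R)
          ≤ G.annulusResistance x R (2 * R) := by
  obtain ⟨C, hC1, hC⟩ := WeightedGraph.exists_annulusResistance_le hconn hp0 hH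
  refine ⟨C + 1, by linarith, fun x R hR => ?_⟩
  rw [add_sub_cancel_right]
  obtain ⟨hinner, houter⟩ := hC x R hR
  have hmono : G.annulusResistance x R (2 * R) ≤ G.annulusResistance x R (4 * R) :=
    WeightedGraph.annulusResistance_mono x le_rfl (by linarith)
  have hmono' : G.annulusResistance x (2 * R) (4 * R) ≤ G.annulusResistance x R (4 * R) :=
    WeightedGraph.annulusResistance_mono x (by linarith) le_rfl
  have hweaken : ENNReal.ofReal C ≤ ENNReal.ofReal (C + 1) :=
    ENNReal.ofReal_le_ofReal (by linarith)
  exact ⟨hinner.trans (by gcongr), hmono.trans hinner, houter.trans (by gcongr),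
    hmono'.trans houter,
    WeightedGraph.ofReal_one_div_mul_le (by linarith) (hmono'.trans houter)⟩

theorem mainTheorem9 {Γ : Type*} [Countable Γ] [Infinite Γ] (G : WeightedGraph Γ)
    (hconn : G.graph.Connected) (hp0 : G.CondP0) (hH : G.EllipticHarnack) :
    ∃ C₂ : ℝ, 1 < C₂ ∧
      (∀ (x : Γ) (R : ℝ), 0 < R →
        G.annulusResistance x R (4 * R)
            ≤ ENNReal.ofReal C₂ * G.annulusResistance x (2 * R) (4 * R) ∧
        G.annulusResistance x R (2 * R)
            ≤ ENNReal.ofReal (C₂ - 1) * G.annulusResistance x (2 * R) (4 * R)) ∧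
      (G.BoundedCovering →
        ∃ C₁ : ℝ, 1 < C₁ ∧
          ∀ (x : Γ) (R : ℝ), 0 < R →
            G.annulusResistance x R (4 * R)
                ≤ ENNReal.ofReal C₁ * G.annulusResistance x R (2 * R) ∧
            G.annulusResistance x (2 * R) (4 * R)
                ≤ ENNReal.ofReal (C₁ - 1) * G.annulusResistance x R (2 * R) ∧
            ENNReal.ofReal (1 / (C₁ - 1)) * G.annulusResistance x (2 * R) (4 * R)
                ≤ G.annulusResistance x R (2 * R) ∧
            G.annulusResistance x R (2 * R)
                ≤ ENNReal.ofReal (C₂ - 1) * G.annulusResistance x (2 * R) (4 * R)) := by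
  obtain ⟨C, hC, h⟩ := mainTheorem9_general G hconn hp0 hH
  refine ⟨C, hC, fun x R hR => ⟨(h x R hR).1, (h x R hR).2.1⟩,
    fun _ => ⟨C, hC, fun x R hR => ?_⟩⟩
  exact ⟨(h x R hR).2.2.1, (h x R hR).2.2.2.1, (h x R hR).2.2.2.2, (h x R hR).2.1⟩
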